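/- Let $F$ be a tree of order $\ell\ge 4$ with partite sets $A$ and $B$, $|A|\le |B|$; put $q=|A|-1$ and $\delta=\min\{d_F(x):x\in A\}$. For a graph $G$ let $\rho(G)$ be its spectral radius, i.e. the largest eigenvalue of its adjacency matrix, and let $\mathrm{spex}(n,F)$ be the maximum of $\rho(G)$ over all graphs $G$ of order $n$ that are $F$-free (contain no subgraph isomorphic to $F$). For $n\ge q+2$ let $S_{n,q}^{1}$ be the graph obtained from the join $K_q\nabla (n-q)K_1$ by adding one edge inside the independent set $(n-q)K_1$. Suppose $q\ge 1$ and $\delta\ge 2$. Then $S_{n,q}^{1}$ is $F$-free for every $n\ge q+2$. Moreover, for all sufficiently large $n$ (depending on $F$), $$\frac{q-1}{2}+\sqrt{qn-\frac{3q^2+2q+1}{4}}<\mathrm{spex}(n,F)\le \rho(J),\qquad J=\begin{bmatrix} q-1 & n-q\\ q & \delta-1\end{bmatrix},$$ where $\rho(J)$ is the largest eigenvalue of $J$, and, as $n\to\infty$ with $F$ fixed, $$\rho(J)=\sqrt{qn}+\frac{q+\delta-2}{2}+O\Big(\frac{1}{\sqrt n}\Big).$$ -/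

import Mathlib

/-- The largest real eigenvalue of a real square matrix. For an adjacency matrix, and for any
`2 × 2` matrix with nonnegative entries, this is the spectral radius. -/
noncomputable def matrixRho {m : Type*} [Fintype m] [DecidableEq m] (M : Matrix m m ℝ) : ℝ :=
  sSup (spectrum ℝ M)

open Classical in
/-- The spectral radius of a finite graph: the largest eigenvalue of its adjacency matrix. -/
noncomputable def graphRho {V : Type*} [Fintype V] (G : SimpleGraph V) : ℝ :=
  matrixRho (G.adjMatrix ℝ)

/-- `spex n F` is the maximum spectral radius over all `F`-free graphs of order `n`. -/
noncomputable def spex {V : Type*} (n : ℕ) (F : SimpleGraph V) : ℝ :=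
  sSup {r : ℝ | ∃ G : SimpleGraph (Fin n), F.Free G ∧ graphRho G = r}

/-- The graph `S_{n,k}^p`, meant for `0 < k < n` and `2 * p ≤ n - k`: the join of the complete
graph on the vertices `0, …, k - 1` and the edgeless graph on `k, …, n - 1`, together with the
`p` independent edges `{k + 2t, k + 2t + 1}`, `t < p`. -/
def splitGraph (n k p : ℕ) : SimpleGraph (Fin n) :=
  SimpleGraph.fromRel fun i j =>
    (i : ℕ) < k ∨ ∃ t < p, (i : ℕ) = k + 2 * t ∧ (j : ℕ) = k + 2 * t + 1

/-- The matrix `J` with rows `(q - 1, n - q)` and `(q, δ - 1)`. -/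
def matrixJ (n q δ : ℕ) : Matrix (Fin 2) (Fin 2) ℝ :=
  !![(q : ℝ) - 1, (n : ℝ) - q; (q : ℝ), (δ : ℝ) - 1]

/-!
Upper bound. Let `x` be the Perron vector, with largest entry `1`, of an `F`-free graph `G` of order
`n` with `ρ(G) ≥ √(qn)`. Being free of a forest, `G` is degenerate, so only boundedly many vertices
have weight above a small constant `η`, and the light ones contribute little to the two-step
equation `ρ² x_v = ∑_{u ~ v} ∑_{w ~ u} x_w`. Since `q + 1` vertices have boundedly many common
neighbours, almost every `u` has at most `q` heavy neighbours. Applied where `x_v = 1`, the equation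
thus yields a set `L` of `q` vertices of weight almost `1`; these are adjacent to almost all
vertices, and every vertex outside `L` has small weight and fewer than `δ` neighbours among the
common neighbours of `L`. Now join `L` to everything and, outside `L`, keep only the edges between
common neighbours of `L`. Each vertex that was not yet joined to `L` gains almost its weight in
`xᵀAx`, which outweighs the lost edges, so `ρ` does not decrease; and `(ρ(J) - δ + 1, q)`, constant
on `L` and on its complement, is a supersolution of the new eigenvalue equation, so `ρ ≤ ρ(J)`.

Lower bound. Of the edges of `F` at least two survive the deletion of any `q < |A|` vertices, since
those at the remaining vertices of `A` outnumber what a forest allows towards the deleted ones. So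
`F` does not embed into `S_{n,q}^1`, whose spectral radius is at least that of `J` with `δ = 1`.
-/

open Finset Filter Asymptotics SimpleGraph
open scoped Matrix

section Matrices

variable {m : Type*} [Fintype m] [DecidableEq m] {M : Matrix m m ℝ}

theorem matrixRho_mem_spectrum [Nonempty m] (hM : M.IsHermitian) : matrixRho M ∈ spectrum ℝ M :=
  Set.Nonempty.csSup_mem ⟨_, hM.eigenvalues_mem_spectrum_real (Classical.arbitrary m)⟩
    Matrix.finite_real_spectrum

theorem posSemidef_matrixRho_smul_one_sub (hM : M.IsHermitian) :
    (matrixRho M • (1 : Matrix m m ℝ) - M).PosSemidef := by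
  rw [← Algebra.algebraMap_eq_smul_one, Matrix.posSemidef_iff_isHermitian_and_spectrum_nonneg]
  constructor
  · rw [Matrix.algebraMap_eq_diagonal]
    exact (Matrix.isHermitian_diagonal _).sub hM
  · rw [← spectrum.singleton_sub_eq]
    rintro _ ⟨_, rfl, r, hr, rfl⟩
    exact sub_nonneg.2 (le_csSup Matrix.finite_real_spectrum.bddAbove hr)

theorem dotProduct_matrixRho_smul_one_sub_mulVec (M : Matrix m m ℝ) (x : m → ℝ) :
    x ⬝ᵥ ((matrixRho M • (1 : Matrix m m ℝ) - M) *ᵥ x) =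
      matrixRho M * (x ⬝ᵥ x) - x ⬝ᵥ (M *ᵥ x) := by
  rw [Matrix.sub_mulVec, Matrix.smul_mulVec, Matrix.one_mulVec, dotProduct_sub, dotProduct_smul,
    smul_eq_mul]

theorem dotProduct_mulVec_le_matrixRho_mul (hM : M.IsHermitian) (x : m → ℝ) :
    x ⬝ᵥ (M *ᵥ x) ≤ matrixRho M * (x ⬝ᵥ x) := by
  have h := (posSemidef_matrixRho_smul_one_sub hM).dotProduct_mulVec_nonneg x
  rw [star_trivial, dotProduct_matrixRho_smul_one_sub_mulVec] at h
  exact sub_nonneg.1 h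

theorem mulVec_eq_matrixRho_smul_of_le (hM : M.IsHermitian) {x : m → ℝ}
    (hx : matrixRho M * (x ⬝ᵥ x) ≤ x ⬝ᵥ (M *ᵥ x)) : M *ᵥ x = matrixRho M • x := by
  have h : star x ⬝ᵥ ((matrixRho M • (1 : Matrix m m ℝ) - M) *ᵥ x) = 0 := by
    rw [star_trivial, dotProduct_matrixRho_smul_one_sub_mulVec, sub_eq_zero]
    exact hx.antisymm (dotProduct_mulVec_le_matrixRho_mul hM x)
  rw [(posSemidef_matrixRho_smul_one_sub hM).dotProduct_mulVec_zero_iff, Matrix.sub_mulVec,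
    Matrix.smul_mulVec, Matrix.one_mulVec, sub_eq_zero] at h
  exact h.symm

theorem exists_nonneg_mulVec_eq_matrixRho_smul [Nonempty m] (hM : M.IsHermitian)
    (hM0 : ∀ i j, 0 ≤ M i j) : ∃ x : m → ℝ, x ≠ 0 ∧ 0 ≤ x ∧ M *ᵥ x = matrixRho M • x := by
  have hmem := matrixRho_mem_spectrum hM
  rw [← Matrix.spectrum_toLin', ← Module.End.hasEigenvalue_iff_mem_spectrum] at hmem
  obtain ⟨x, hx⟩ := hmem.exists_hasEigenvector
  have hMx : M *ᵥ x = matrixRho M • x := by simpa using hx.apply_eq_smul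
  refine ⟨|x|, fun h => hx.2 (funext fun i => abs_eq_zero.1 (congrFun h i)), abs_nonneg x,
    mulVec_eq_matrixRho_smul_of_le hM ?_⟩
  calc matrixRho M * (|x| ⬝ᵥ |x|) = x ⬝ᵥ (M *ᵥ x) := by
        rw [hMx, dotProduct_smul, smul_eq_mul]; simp [dotProduct]
    _ ≤ |x| ⬝ᵥ (M *ᵥ |x|) := by
        simp only [dotProduct, Matrix.mulVec, mul_sum, Pi.abs_apply]
        refine sum_le_sum fun i _ => sum_le_sum fun j _ => ?_
        calc x i * (M i j * x j) ≤ |x i * (M i j * x j)| := le_abs_self _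
          _ = |x i| * (M i j * |x j|) := by simp [abs_mul, abs_of_nonneg (hM0 i j)]

theorem matrixRho_fin_two {a b c d : ℝ} (h : 0 ≤ ((a - d) / 2) ^ 2 + b * c) :
    matrixRho !![a, b; c, d] = (a + d) / 2 + √(((a - d) / 2) ^ 2 + b * c) := by
  set s := √(((a - d) / 2) ^ 2 + b * c)
  have hs : s * s = ((a - d) / 2) ^ 2 + b * c := Real.mul_self_sqrt h
  have hspec : ∀ r : ℝ, r ∈ spectrum ℝ !![a, b; c, d] ↔
      (r - ((a + d) / 2 + s)) * (r - ((a + d) / 2 - s)) = 0 := by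
    intro r
    rw [spectrum.mem_iff, Matrix.isUnit_iff_isUnit_det, isUnit_iff_ne_zero, not_not,
      Matrix.det_fin_two]
    have hdet : (r - a) * (r - d) - -b * -c =
        (r - ((a + d) / 2 + s)) * (r - ((a + d) / 2 - s)) := by
      linear_combination hs
    simp [Matrix.algebraMap_matrix_apply, ← hdet]
  refine IsGreatest.csSup_eq ⟨(hspec _).2 (by ring), fun r hr => ?_⟩
  have hs0 : 0 ≤ s := Real.sqrt_nonneg _
  rcases mul_eq_zero.1 ((hspec r).1 hr) with h | h <;> linarith

theorem matrixRho_fin_two_sub_mul_sub {a b c d : ℝ} (h : 0 ≤ ((a - d) / 2) ^ 2 + b * c) :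
    (matrixRho !![a, b; c, d] - a) * (matrixRho !![a, b; c, d] - d) = b * c := by
  rw [matrixRho_fin_two h]
  linear_combination Real.mul_self_sqrt h

theorem lt_matrixRho_fin_two {a b c d : ℝ} (h : 0 < b * c) : d < matrixRho !![a, b; c, d] := by
  rw [matrixRho_fin_two (by positivity)]
  have : |(a - d) / 2| < √(((a - d) / 2) ^ 2 + b * c) :=
    Real.lt_sqrt_of_sq_lt (by rw [sq_abs]; linarith)
  linarith [neg_abs_le ((a - d) / 2)]

end Matrices

section GraphSpectrum

variable {W : Type*} [Fintype W]

theorem graphRho_eq_matrixRho [DecidableEq W] (G : SimpleGraph W) [DecidableRel G.Adj] :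
    graphRho G = matrixRho (G.adjMatrix ℝ) := by
  unfold graphRho
  congr!

/-- The quadratic form of the adjacency matrix of `G` at the restriction of `x` to `S`; every edge
inside `S` is counted in both directions. -/
def adjForm {W : Type*} (G : SimpleGraph W) [DecidableRel G.Adj] (x : W → ℝ) (S : Finset W) : ℝ :=
  ∑ u ∈ S, ∑ w ∈ S with G.Adj u w, x u * x w

theorem sum_sum_adj_comm {W M : Type*} [AddCommMonoid M] (G : SimpleGraph W) [DecidableRel G.Adj]
    (S T : Finset W) (f : W → W → M) :
    ∑ u ∈ S, ∑ w ∈ T with G.Adj u w, f u w = ∑ w ∈ T, ∑ u ∈ S with G.Adj w u, f u w := by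
  simp only [sum_filter]
  rw [sum_comm]
  exact sum_congr rfl fun w _ => sum_congr rfl fun u _ => if_congr (G.adj_comm u w) rfl rfl

theorem adjForm_union {W : Type*} [DecidableEq W] (G : SimpleGraph W) [DecidableRel G.Adj]
    (x : W → ℝ) {S T : Finset W} (hST : Disjoint S T) :
    adjForm G x (S ∪ T) =
      adjForm G x S + 2 * ∑ u ∈ T, ∑ w ∈ S with G.Adj u w, x u * x w + adjForm G x T := by
  have hswap : ∑ u ∈ S, ∑ w ∈ T with G.Adj u w, x u * x w =
      ∑ u ∈ T, ∑ w ∈ S with G.Adj u w, x u * x w := by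
    rw [sum_sum_adj_comm]
    simp only [mul_comm]
  have hinner (u : W) : ∑ w ∈ S ∪ T with G.Adj u w, x u * x w =
      ∑ w ∈ S with G.Adj u w, x u * x w + ∑ w ∈ T with G.Adj u w, x u * x w := by
    rw [filter_union, sum_union (disjoint_filter_filter hST)]
  simp only [adjForm, sum_union hST, hinner, sum_add_distrib, hswap]
  ring

variable (G : SimpleGraph W) [DecidableRel G.Adj]

theorem dotProduct_adjMatrix_mulVec (x : W → ℝ) :
    x ⬝ᵥ (G.adjMatrix ℝ *ᵥ x) = adjForm G x univ := by
  simp only [dotProduct, adjMatrix_mulVec_apply, adjForm, mul_sum, neighborFinset_eq_filter]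

theorem adjForm_univ_le (x : W → ℝ) : adjForm G x univ ≤ graphRho G * ∑ v, x v * x v := by
  classical
  rw [graphRho_eq_matrixRho, ← dotProduct_adjMatrix_mulVec]
  exact dotProduct_mulVec_le_matrixRho_mul (isSymm_adjMatrix G) x

variable {G}

theorem le_graphRho_of_le_sum {r : ℝ} {y : W → ℝ} (hy : 0 ≤ y) (hy0 : y ≠ 0)
    (h : ∀ v, r * y v ≤ ∑ w ∈ G.neighborFinset v, y w) : r ≤ graphRho G := by
  have hpos : 0 < ∑ v, y v * y v := by
    obtain ⟨v, hv⟩ := Function.ne_iff.1 hy0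
    exact sum_pos' (fun i _ => mul_self_nonneg _) ⟨v, mem_univ v, mul_self_pos.2 hv⟩
  refine le_of_mul_le_mul_right ?_ hpos
  calc r * ∑ v, y v * y v = ∑ v, y v * (r * y v) := by
        rw [mul_sum]; exact sum_congr rfl fun v _ => by ring
    _ ≤ ∑ v, y v * ∑ w ∈ G.neighborFinset v, y w :=
        sum_le_sum fun v _ => mul_le_mul_of_nonneg_left (h v) (hy v)
    _ = adjForm G y univ := by simp only [adjForm, mul_sum, neighborFinset_eq_filter]
    _ ≤ graphRho G * ∑ v, y v * y v := adjForm_univ_le G y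

/-- `x` is a nonnegative eigenvector of `G` for the eigenvalue `graphRho G`, scaled so that its
largest entry is `1`. -/
structure IsPerronVector (G : SimpleGraph W) [DecidableRel G.Adj] (x : W → ℝ) : Prop where
  nonneg : ∀ v, 0 ≤ x v
  le_one : ∀ v, x v ≤ 1
  exists_eq_one : ∃ v, x v = 1
  graphRho_mul : ∀ v, graphRho G * x v = ∑ w ∈ G.neighborFinset v, x w

theorem exists_isPerronVector [Nonempty W] (G : SimpleGraph W) [DecidableRel G.Adj] :
    ∃ x, IsPerronVector G x := by
  classical
  obtain ⟨x, hx0, hx, heigen⟩ := exists_nonneg_mulVec_eq_matrixRho_smul (M := G.adjMatrix ℝ)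
    (isSymm_adjMatrix G) fun i j => by rw [adjMatrix_apply]; split_ifs <;> norm_num
  obtain ⟨z, hz⟩ := Finite.exists_max x
  have hzpos : 0 < x z := by
    obtain ⟨v, hv⟩ := Function.ne_iff.1 hx0
    exact ((hx v).lt_of_ne' hv).trans_le (hz v)
  refine ⟨fun v => x v / x z, fun v => div_nonneg (hx v) hzpos.le,
    fun v => (div_le_one hzpos).2 (hz v), ⟨z, div_self hzpos.ne'⟩, fun v => ?_⟩
  rw [← sum_div, ← adjMatrix_mulVec_apply, heigen, graphRho_eq_matrixRho, Pi.smul_apply,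
    smul_eq_mul, mul_div_assoc]

namespace IsPerronVector

variable {x : W → ℝ}

theorem adjForm_univ (hx : IsPerronVector G x) :
    adjForm G x univ = graphRho G * ∑ v, x v * x v := by
  simp only [adjForm, ← mul_sum, ← neighborFinset_eq_filter, ← hx.graphRho_mul]
  rw [mul_sum]
  exact sum_congr rfl fun v _ => by ring

theorem sum_mul_self_pos (hx : IsPerronVector G x) : 0 < ∑ v, x v * x v := by
  obtain ⟨z, hz⟩ := hx.exists_eq_one
  exact sum_pos' (fun v _ => mul_self_nonneg _) ⟨z, mem_univ z, by simp [hz]⟩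

end IsPerronVector

theorem graphRho_le_of_adjForm_le {H : SimpleGraph W} [DecidableRel H.Adj] {x : W → ℝ}
    (hx : IsPerronVector G x) (h : adjForm G x univ ≤ adjForm H x univ) :
    graphRho G ≤ graphRho H := by
  refine le_of_mul_le_mul_right ?_ hx.sum_mul_self_pos
  rw [← hx.adjForm_univ]
  exact h.trans (adjForm_univ_le H x)

theorem graphRho_le_of_sum_le [Nonempty W] {r : ℝ} {y : W → ℝ} (hy : ∀ v, 0 < y v)
    (h : ∀ v, ∑ w ∈ G.neighborFinset v, y w ≤ r * y v) : graphRho G ≤ r := by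
  obtain ⟨x, hx⟩ := exists_isPerronVector G
  have hpos : 0 < ∑ v, x v * y v := by
    obtain ⟨z, hz⟩ := hx.exists_eq_one
    exact sum_pos' (fun v _ => mul_nonneg (hx.nonneg v) (hy v).le)
      ⟨z, mem_univ z, by simpa [hz] using hy z⟩
  refine le_of_mul_le_mul_right ?_ hpos
  calc graphRho G * ∑ v, x v * y v = ∑ v, ∑ w with G.Adj v w, x w * y v := by
        simp only [mul_sum, ← mul_assoc, hx.graphRho_mul, sum_mul, neighborFinset_eq_filter]
    _ = ∑ w, ∑ v with G.Adj w v, x w * y v := sum_sum_adj_comm G _ _ fun v w => x w * y v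
    _ ≤ ∑ w, x w * (r * y w) := sum_le_sum fun w _ => by
        rw [← mul_sum, ← neighborFinset_eq_filter]
        exact mul_le_mul_of_nonneg_left (h w) (hx.nonneg w)
    _ = r * ∑ v, x v * y v := by rw [mul_sum]; exact sum_congr rfl fun v _ => by ring

end GraphSpectrum

section MatrixJ

theorem matrixJ_discr_nonneg {n q : ℕ} (δ : ℕ) (hn : q ≤ n) :
    0 ≤ (((q : ℝ) - 1 - (δ - 1)) / 2) ^ 2 + (n - q) * q :=
  add_nonneg (sq_nonneg _) (mul_nonneg (sub_nonneg.2 (Nat.cast_le.2 hn)) q.cast_nonneg)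

theorem matrixRho_matrixJ {n q : ℕ} (δ : ℕ) (hn : q ≤ n) :
    matrixRho (matrixJ n q δ) =
      ((q : ℝ) + δ - 2) / 2 + √(((q : ℝ) - δ) ^ 2 / 4 + q * (n - q)) := by
  rw [matrixJ, matrixRho_fin_two (matrixJ_discr_nonneg δ hn)]
  congr 2 <;> ring

theorem matrixRho_matrixJ_sub_mul_sub {n q : ℕ} (δ : ℕ) (hn : q ≤ n) :
    (matrixRho (matrixJ n q δ) - (q - 1)) * (matrixRho (matrixJ n q δ) - (δ - 1)) = (n - q) * q :=
  matrixRho_fin_two_sub_mul_sub (matrixJ_discr_nonneg δ hn)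

theorem lt_matrixRho_matrixJ {n q : ℕ} (δ : ℕ) (hq : 1 ≤ q) (hn : q < n) :
    (δ : ℝ) - 1 < matrixRho (matrixJ n q δ) :=
  lt_matrixRho_fin_two (mul_pos (sub_pos.2 (Nat.cast_lt.2 hn)) (Nat.cast_pos.2 hq))

theorem abs_sqrt_sub_sqrt_le {a b : ℝ} (ha : 0 ≤ a) (hb : 0 < b) : |√a - √b| ≤ |a - b| / √b := by
  have hfactor : a - b = (√a - √b) * (√a + √b) := by
    linear_combination Real.mul_self_sqrt hb.le - Real.mul_self_sqrt ha
  rw [le_div_iff₀ (Real.sqrt_pos.2 hb), hfactor, abs_mul,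
    abs_of_nonneg (add_nonneg (Real.sqrt_nonneg a) (Real.sqrt_nonneg b))]
  exact mul_le_mul_of_nonneg_left (by linarith [Real.sqrt_nonneg a]) (abs_nonneg _)

theorem matrixRho_matrixJ_isBigO {q : ℕ} (δ : ℕ) (hq : 1 ≤ q) :
    (fun n : ℕ => matrixRho (matrixJ n q δ) - (√((q : ℝ) * n) + ((q : ℝ) + δ - 2) / 2))
      =O[atTop] (fun n : ℕ => 1 / √(n : ℝ)) := by
  refine .of_bound |((q : ℝ) - δ) ^ 2 / 4 - q ^ 2| ?_
  filter_upwards [eventually_ge_atTop q] with n hn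
  have hq' : (1 : ℝ) ≤ q := by exact_mod_cast hq
  have hn' : (q : ℝ) ≤ n := by exact_mod_cast hn
  have hn0 : (0 : ℝ) < n := by linarith
  rw [matrixRho_matrixJ δ hn, Real.norm_eq_abs, Real.norm_of_nonneg (by positivity)]
  calc |((q : ℝ) + δ - 2) / 2 + √(((q : ℝ) - δ) ^ 2 / 4 + q * (n - q)) -
        (√((q : ℝ) * n) + ((q : ℝ) + δ - 2) / 2)|
      = |√(((q : ℝ) - δ) ^ 2 / 4 + q * (n - q)) - √((q : ℝ) * n)| := by ring_nf
    _ ≤ |((q : ℝ) - δ) ^ 2 / 4 + q * (n - q) - q * n| / √((q : ℝ) * n) := by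
        have := sub_nonneg.2 hn'
        exact abs_sqrt_sub_sqrt_le (by positivity) (by positivity)
    _ = |((q : ℝ) - δ) ^ 2 / 4 - q ^ 2| / √((q : ℝ) * n) := by ring_nf
    _ ≤ |((q : ℝ) - δ) ^ 2 / 4 - q ^ 2| / √(n : ℝ) := by
        gcongr
        nlinarith
    _ = |((q : ℝ) - δ) ^ 2 / 4 - q ^ 2| * (1 / √(n : ℝ)) := by rw [mul_one_div]

theorem eventually_sqrt_le_matrixRho_matrixJ {q δ : ℕ} (hq : 1 ≤ q) (hqδ : 2 < q + δ) :
    ∀ᶠ n : ℕ in atTop, √((q : ℝ) * n) ≤ matrixRho (matrixJ n q δ) := by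
  have hinv : Tendsto (fun n : ℕ => 1 / √(n : ℝ)) atTop (nhds 0) := by
    simp only [one_div]
    exact (Real.tendsto_sqrt_atTop.comp tendsto_natCast_atTop_atTop).inv_tendsto_atTop
  have hlim := (matrixRho_matrixJ_isBigO δ hq).trans_tendsto hinv
  filter_upwards [hlim.eventually (lt_mem_nhds (show (-1 / 2 : ℝ) < 0 by norm_num))] with n hn
  have hqδ' : (3 : ℝ) ≤ q + δ := by exact_mod_cast hqδ
  linarith

theorem lt_matrixRho_matrixJ_one {n q : ℕ} (hq : 1 ≤ q) (hn : q < n) :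
    ((q : ℝ) - 1) / 2 + √((q : ℝ) * n - (3 * (q : ℝ) ^ 2 + 2 * q + 1) / 4) <
      matrixRho (matrixJ n q 1) := by
  have hn' : (0 : ℝ) < n - q := sub_pos.2 (Nat.cast_lt.2 hn)
  have hradicand : (q : ℝ) * n - (3 * (q : ℝ) ^ 2 + 2 * q + 1) / 4 <
      ((q : ℝ) - 1) ^ 2 / 4 + q * (n - q) := by linarith
  have hsqrt := (Real.sqrt_lt_sqrt_iff_of_pos (by positivity)).2 hradicand
  rw [matrixRho_matrixJ 1 hn.le, Nat.cast_one]
  linarith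

end MatrixJ

section DominatingClique

variable {W : Type*} [Fintype W] {G : SimpleGraph W} {L : Finset W}

/-- `L` is a set of universal vertices of `G`, so that `G` is the join of the complete graph on `L`
and the subgraph induced outside `L`. -/
def IsDominatingClique {W : Type*} (G : SimpleGraph W) (L : Finset W) : Prop :=
  ∀ u ∈ L, ∀ v, u ≠ v → G.Adj u v

/-- The vector with value `ρ(J) - (δ - 1)` on `L` and `#L` elsewhere. These are the entries of an
eigenvector of `J` for its largest eigenvalue, and `J` is the quotient matrix of the join of `K_q`
and a `(δ - 1)`-regular graph. -/
noncomputable def joinVector [DecidableEq W] (L : Finset W) (δ : ℕ) (v : W) : ℝ :=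
  if v ∈ L then matrixRho (matrixJ (Fintype.card W) #L δ) - (δ - 1) else #L

variable [DecidableEq W]

theorem joinVector_pos (hL0 : L.Nonempty) (hL1 : L ≠ univ) (δ : ℕ) (v : W) :
    0 < joinVector L δ v := by
  rw [joinVector]
  split_ifs
  · exact sub_pos.2 (lt_matrixRho_matrixJ δ hL0.card_pos ((card_lt_iff_ne_univ L).2 hL1))
  · exact Nat.cast_pos.2 hL0.card_pos

theorem sum_joinVector (S : Finset W) (δ : ℕ) :
    ∑ w ∈ S, joinVector L δ w =
      #{w ∈ S | w ∈ L} * (matrixRho (matrixJ (Fintype.card W) #L δ) - (δ - 1)) +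
        #{w ∈ S | w ∉ L} * #L := by
  simp only [joinVector, sum_ite, sum_const, nsmul_eq_mul]

variable [DecidableRel G.Adj]

theorem sum_neighborFinset_joinVector_of_mem (hL : IsDominatingClique G L) (δ : ℕ) {v : W}
    (hv : v ∈ L) : ∑ w ∈ G.neighborFinset v, joinVector L δ w =
      matrixRho (matrixJ (Fintype.card W) #L δ) * joinVector L δ v := by
  have hN : G.neighborFinset v = univ.erase v := by
    ext w
    simpa [eq_comm] using ⟨fun h => G.ne_of_adj h, hL v hv w⟩
  have hin : #{w | w ∈ L} = #L := by simp
  have hout : (#{w | w ∉ L} : ℝ) = Fintype.card W - #L := by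
    rw [filter_notMem_eq_sdiff, ← compl_eq_univ_sdiff, card_compl, Nat.cast_sub (card_le_univ L)]
  rw [hN, sum_erase_eq_sub (mem_univ v), sum_joinVector, hin, hout, joinVector, if_pos hv]
  linear_combination -matrixRho_matrixJ_sub_mul_sub δ (card_le_univ L)

theorem sum_neighborFinset_joinVector_of_notMem (hL : IsDominatingClique G L) (δ : ℕ) {v : W}
    (hv : v ∉ L) : ∑ w ∈ G.neighborFinset v, joinVector L δ w =
      matrixRho (matrixJ (Fintype.card W) #L δ) * joinVector L δ v +
        #L * (#{w ∈ G.neighborFinset v | w ∉ L} - (δ - 1)) := by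
  have hin : {w ∈ G.neighborFinset v | w ∈ L} = L := by
    ext w
    simpa using fun hw => (hL w hw v (by rintro rfl; exact hv hw)).symm
  rw [sum_joinVector, hin, joinVector, if_neg hv]
  ring

theorem graphRho_le_matrixRho_matrixJ (hL : IsDominatingClique G L) (hL0 : L.Nonempty)
    (hL1 : L ≠ univ) {δ : ℕ} (h : ∀ v ∉ L, #{w ∈ G.neighborFinset v | w ∉ L} < δ) :
    graphRho G ≤ matrixRho (matrixJ (Fintype.card W) #L δ) := by
  have : Nonempty W := hL0.to_type
  refine graphRho_le_of_sum_le (joinVector_pos hL0 hL1 δ) fun v => ?_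
  by_cases hv : v ∈ L
  · exact (sum_neighborFinset_joinVector_of_mem hL δ hv).le
  · have hlt : (#{w ∈ G.neighborFinset v | w ∉ L} : ℝ) + 1 ≤ δ := by exact_mod_cast h v hv
    rw [sum_neighborFinset_joinVector_of_notMem hL δ hv]
    nlinarith [(#L).cast_nonneg (α := ℝ)]

theorem matrixRho_matrixJ_le_graphRho (hL : IsDominatingClique G L) (hL0 : L.Nonempty)
    (hL1 : L ≠ univ) {δ : ℕ} (h : ∀ v ∉ L, δ ≤ #{w ∈ G.neighborFinset v | w ∉ L} + 1) :
    matrixRho (matrixJ (Fintype.card W) #L δ) ≤ graphRho G := by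
  have hpos := joinVector_pos hL0 hL1 δ
  refine le_graphRho_of_le_sum (fun v => (hpos v).le)
    (Function.ne_iff.2 (hL0.imp fun v _ => (hpos v).ne')) fun v => ?_
  by_cases hv : v ∈ L
  · exact (sum_neighborFinset_joinVector_of_mem hL δ hv).ge
  · have hle : (δ : ℝ) ≤ #{w ∈ G.neighborFinset v | w ∉ L} + 1 := by exact_mod_cast h v hv
    rw [sum_neighborFinset_joinVector_of_notMem hL δ hv]
    nlinarith [(#L).cast_nonneg (α := ℝ)]

end DominatingClique

section Embedding

variable {V W : Type*}

theorem isContained_of_induce_compl_singleton {F : SimpleGraph V} {G : SimpleGraph W} {u v : V}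
    (huv : u ≠ v) (hleaf : ∀ a, F.Adj v a → a = u) (f : Copy (F.induce {v}ᶜ) G) {w : W}
    (hw : w ∉ Set.range f) (hadj : G.Adj (f ⟨u, huv⟩) w) : F ⊑ G := by
  classical
  let g : V → W := fun a => if h : a = v then w else f ⟨a, h⟩
  have hgv : g v = w := dif_pos rfl
  have hg (a : V) (ha : a ≠ v) : g a = f ⟨a, ha⟩ := dif_neg ha
  have hgne (a : V) (ha : a ≠ v) : g a ≠ w := fun h => hw ⟨⟨a, ha⟩, by rw [← hg a ha, h]⟩
  have hginj : Function.Injective g := by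
    intro a b hab
    by_cases ha : a = v <;> by_cases hb : b = v
    · rw [ha, hb]
    · exact absurd (by rw [← hab, ha, hgv]) (hgne b hb)
    · exact absurd (by rw [hab, hb, hgv]) (hgne a ha)
    · rw [hg a ha, hg b hb] at hab
      exact congrArg Subtype.val (f.injective hab)
  have hgleaf (b : V) (hb : F.Adj v b) : G.Adj (g b) (g v) := by
    obtain rfl := hleaf b hb
    rwa [hgv, hg b huv]
  refine ⟨⟨g, fun {a b} hab => ?_⟩, hginj⟩
  by_cases ha : a = v
  · subst ha
    exact (hgleaf b hab).symm
  by_cases hb : b = v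
  · subst hb
    exact hgleaf a hab.symm
  · rw [hg a ha, hg b hb]
    exact f.toHom.map_rel (a := ⟨a, ha⟩) (b := ⟨b, hb⟩) hab

theorem isContained_of_isTree [Fintype V] {F : SimpleGraph V} (hF : F.IsTree) [Nonempty W]
    {G : SimpleGraph W} [G.LocallyFinite] (hG : ∀ w, Fintype.card V ≤ G.degree w + 1) :
    F ⊑ G := by
  classical
  induction hn : Fintype.card V using Nat.strong_induction_on generalizing V with | _ n ih
  subst hn
  rcases subsingleton_or_nontrivial V with _ | _
  · exact ⟨⟨fun _ => Classical.arbitrary W, fun hab => absurd (Subsingleton.elim _ _) hab.ne⟩,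
      Function.injective_of_subsingleton _⟩
  · obtain ⟨v, hv⟩ := hF.exists_vert_degree_one_of_nontrivial
    obtain ⟨u, hu, hleaf⟩ := F.degree_eq_one_iff_existsUnique_adj.1 hv
    have hcard : Fintype.card ({v}ᶜ : Set V) + 1 = Fintype.card V := by
      have := Fintype.card_pos (α := V)
      rw [Fintype.card_compl_set, Set.card_singleton]
      omega
    obtain ⟨f⟩ := ih _ (by omega)
      ⟨hF.connected.induce_compl_singleton_of_degree_eq_one hv, hF.isAcyclic.induce _⟩
      (fun w => (by omega : _ ≤ _).trans (hG w)) rfl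
    let u' : ({v}ᶜ : Set V) := ⟨u, hu.ne'⟩
    -- `f u'` has at least `#V - 1` neighbours, of which at most `#V - 2` are images under `f`.
    have hlt : #((univ.erase u').image f) < #(G.neighborFinset (f u')) := by
      have hpos := Fintype.card_pos_iff.2 ⟨u'⟩
      calc #((univ.erase u').image f) ≤ #(univ.erase u') := card_image_le
        _ = Fintype.card ({v}ᶜ : Set V) - 1 := by rw [card_erase_of_mem (mem_univ _), card_univ]
        _ < #(G.neighborFinset (f u')) := by
          have := hG (f u')
          rw [card_neighborFinset_eq_degree]
          omega
    obtain ⟨w, hw, hwf⟩ := exists_mem_notMem_of_card_lt_card hlt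
    rw [mem_neighborFinset] at hw
    refine isContained_of_induce_compl_singleton hu.ne' hleaf f ?_ hw
    rintro ⟨a, rfl⟩
    exact hwf (mem_image_of_mem f (mem_erase.2 ⟨fun h => hw.ne (by rw [h]), mem_univ a⟩))

/-- `G` is `d`-degenerate: every nonempty finite set of vertices contains one with at most `d`
neighbours in the set. -/
def IsDegenerate (G : SimpleGraph W) [DecidableRel G.Adj] (d : ℕ) : Prop :=
  ∀ S : Finset W, S.Nonempty → ∃ v ∈ S, #{w ∈ S | G.Adj v w} ≤ d

theorem isDegenerate_of_free [Fintype V] {F : SimpleGraph V} (hF : F.IsAcyclic)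
    {G : SimpleGraph W} [DecidableRel G.Adj] (hG : F.Free G) {d : ℕ}
    (hd : Fintype.card V ≤ d + 2) : IsDegenerate G d := by
  classical
  intro S hS
  by_contra! hdeg
  cases isEmpty_or_nonempty V with
  | inl _ => exact hG IsContained.of_isEmpty
  | inr _ =>
    obtain ⟨T, hFT, -, hT⟩ :=
      connected_top.exists_isTree_le_of_le_of_isAcyclic (le_top (a := F)) hF
    have : Nonempty S := hS.to_subtype
    have hS' (w : (S : Set W)) :
        (G.induce S).degree w = #{z ∈ S | G.Adj w z} := by
      rw [← card_neighborFinset_eq_degree, ← card_map (Function.Embedding.subtype _)]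
      congr 1
      ext z
      simp [and_comm]
    have hTG : T ⊑ G.induce S := isContained_of_isTree hT fun w => by
      have := hdeg w w.2
      rw [hS']
      omega
    exact hG ((IsContained.of_le hFT).trans (hTG.trans ⟨(Embedding.induce _).toCopy⟩))

theorem exists_injOn_mapsTo_of_subset [Nonempty W] {s s' : Finset V} {t t' : Finset W}
    (hs : s' ⊆ s) (ht : t' ⊆ t) (hcard' : #s' ≤ #t') (hcard : #s ≤ #t) :
    ∃ f : V → W, Set.InjOn f s ∧ (∀ a ∈ s, f a ∈ t) ∧ ∀ a ∈ s', f a ∈ t' := by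
  classical
  have exists_injOn {s : Finset V} {t : Finset W} (h : #s ≤ #t) :
      ∃ f : V → W, (∀ a ∈ s, f a ∈ t) ∧ Set.InjOn f s :=
    s.finite_toSet.exists_injOn_of_encard_le (t := (t : Set W))
      (by simpa [Set.encard_coe_eq_coe_finsetCard] using h)
  obtain ⟨f, hf, hfinj⟩ := exists_injOn hcard'
  have hrest : #(s \ s') ≤ #(t \ s'.image f) := by
    have himage : s'.image f ⊆ t := (image_subset_iff.2 hf).trans ht
    rw [card_sdiff_of_subset hs, card_sdiff_of_subset himage, card_image_of_injOn hfinj]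
    omega
  obtain ⟨g, hg, hginj⟩ := exists_injOn hrest
  refine ⟨s'.piecewise f g, fun a ha b hb hab => ?_, fun a ha => ?_, fun a ha => ?_⟩
  · grind [piecewise, Set.InjOn]
  · grind [piecewise]
  · grind [piecewise]

theorem notMem_of_isBipartiteWith {F : SimpleGraph V} {s t : Set V} (hst : F.IsBipartiteWith s t)
    {a b : V} (ha : a ∈ s) (hab : F.Adj a b) : b ∉ s := fun hb =>
  Set.disjoint_left.1 hst.disjoint hb (hst.mem_of_mem_adj ha hab)

theorem isContained_of_isBipartiteWith {F : SimpleGraph V} {s t : Set V}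
    (hst : F.IsBipartiteWith s t) {G : SimpleGraph W} {f g : V → W} (hf : Set.InjOn f s)
    (hg : Set.InjOn g sᶜ) (hfg : ∀ a ∈ s, ∀ b ∉ s, f a ≠ g b)
    (hadj : ∀ a ∈ s, ∀ b, F.Adj a b → G.Adj (f a) (g b)) : F ⊑ G := by
  classical
  refine ⟨⟨s.piecewise f g, fun {a b} hab => ?_⟩, (Set.injective_piecewise_iff s).2 ⟨hf, hg, hfg⟩⟩
  rcases hst.mem_of_adj hab with ⟨ha, -⟩ | ⟨-, hb⟩
  · simpa [ha, notMem_of_isBipartiteWith hst ha hab] using hadj a ha b hab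
  · simpa [hb, notMem_of_isBipartiteWith hst hb hab.symm] using (hadj b hb a hab.symm).symm

theorem isContained_of_forall_adj [Fintype V] {F : SimpleGraph V} [DecidableRel F.Adj]
    {A B : Finset V} (hAB : F.IsBipartiteWith A B) {G : SimpleGraph W} [DecidableRel G.Adj]
    {L R : Finset W} (hLR : ∀ u ∈ L, ∀ w ∈ R, G.Adj u w) (hL : #A ≤ #L + 1)
    (hR : Fintype.card V ≤ #R) {a₀ : V} (ha₀ : a₀ ∈ A) {v : W} (hv : v ∉ L)
    (hvR : F.degree a₀ ≤ #{w ∈ R | G.Adj v w}) : F ⊑ G := by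
  classical
  have : Nonempty W := ⟨v⟩
  have hAcompl {a b : V} (ha : a ∈ A) (hab : F.Adj a b) : b ∈ Aᶜ :=
    mem_compl.2 (notMem_of_isBipartiteWith hAB ha hab)
  obtain ⟨f, hfinj, hf, hfa₀⟩ := exists_injOn_mapsTo_of_subset (s := A) (s' := {a₀})
    (t := insert v L) (t' := {v}) (by simpa) (by simp) (by simp)
    (by rwa [card_insert_of_notMem hv])
  replace hfa₀ : f a₀ = v := by simpa using hfa₀
  obtain ⟨g, hginj, hg, hga₀⟩ := exists_injOn_mapsTo_of_subset (s := Aᶜ)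
    (s' := F.neighborFinset a₀) (t := R.erase v) (t' := {w ∈ R | G.Adj v w})
    (fun b hb => hAcompl ha₀ ((F.mem_neighborFinset a₀ b).1 hb))
    (fun w hw => mem_erase.2 ⟨(mem_filter.1 hw).2.ne', (mem_filter.1 hw).1⟩)
    (by rwa [card_neighborFinset_eq_degree]) (by
      have := pred_card_le_card_erase (a := v) (s := R)
      have := card_pos.2 ⟨a₀, ha₀⟩
      rw [card_compl]
      omega)
  refine isContained_of_isBipartiteWith hAB hfinj (by rwa [← coe_compl]) (fun a ha b hb => ?_)
    fun a ha b hab => ?_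
  · have hgb := mem_erase.1 (hg b (mem_compl.2 hb))
    rcases mem_insert.1 (hf a ha) with h | h
    · exact h ▸ hgb.1.symm
    · exact (hLR _ h _ hgb.2).ne
  · by_cases haa₀ : a = a₀
    · subst haa₀
      rw [hfa₀]
      exact (mem_filter.1 (hga₀ b ((F.mem_neighborFinset a b).2 hab))).2
    · have hfa : f a ≠ v := fun h => haa₀ (hfinj ha ha₀ (h.trans hfa₀.symm))
      exact hLR _ (mem_of_mem_insert_of_ne (hf a ha) hfa) _
        (mem_of_mem_erase (hg b (hAcompl ha hab)))

end Embedding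

section SplitGraph

variable {V : Type*} [Fintype V] {F : SimpleGraph V}

theorem card_edgeFinset_lt_of_isAcyclic [Nonempty V] [Fintype F.edgeSet] (hF : F.IsAcyclic) :
    #F.edgeFinset < Fintype.card V := by
  classical
  obtain ⟨T, hFT, -, hT⟩ := connected_top.exists_isTree_le_of_le_of_isAcyclic (le_top (a := F)) hF
  have := hT.card_edgeFinset
  have := card_le_card (edgeFinset_mono hFT)
  omega

theorem sum_card_adj_lt_of_isAcyclic {V : Type*} {F : SimpleGraph V} [DecidableRel F.Adj]
    (hF : F.IsAcyclic) {S T : Finset V} (hST : Disjoint S T) (hS : S.Nonempty) :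
    ∑ a ∈ S, #{b ∈ T | F.Adj a b} < #S + #T := by
  classical
  let U : Finset V := S ∪ T
  have : Nonempty U := (hS.mono subset_union_left).to_subtype
  let P : Finset (V × V) := {p ∈ S ×ˢ T | F.Adj p.1 p.2}
  have hP : #(P.image fun p => s(p.1, p.2)) = #P := by
    refine card_image_of_injOn ?_
    rintro ⟨a, b⟩ hab ⟨a', b'⟩ hab' h
    simp only [P, coe_filter, mem_product, Set.mem_ofPred_eq] at hab hab'
    rcases Sym2.eq_iff.1 h with ⟨rfl, rfl⟩ | ⟨rfl, -⟩
    · rfl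
    · exact absurd hab'.1.2 (disjoint_left.1 hST hab.1.1)
  have hPU : P.image (fun p => s(p.1, p.2)) ⊆
      (F.induce (U : Set V)).edgeFinset.image (Sym2.map Subtype.val) := by
    simp only [image_subset_iff, P, mem_filter, mem_product, mem_image, mem_edgeFinset]
    rintro ⟨a, b⟩ ⟨⟨ha, hb⟩, hab⟩
    exact ⟨s(⟨a, mem_union_left T ha⟩, ⟨b, mem_union_right S hb⟩), hab, rfl⟩
  calc ∑ a ∈ S, #{b ∈ T | F.Adj a b} = #P := by
        simp only [P, card_filter, sum_product]
    _ ≤ #(F.induce (U : Set V)).edgeFinset := by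
        rw [← hP]
        exact (card_le_card hPU).trans card_image_le
    _ < #U := by
        simpa using card_edgeFinset_lt_of_isAcyclic (hF.induce (U : Set V))
    _ = #S + #T := card_union_of_disjoint hST

theorem two_le_sum_card_adj_sdiff [DecidableEq V] [DecidableRel F.Adj] (hF : F.IsAcyclic)
    {A P : Finset V} (hA : ∀ a ∈ A, ∀ b, F.Adj a b → b ∉ A) (hdeg : ∀ a ∈ A, 2 ≤ F.degree a)
    (hP : #P < #A) : 2 ≤ ∑ a ∈ A \ P, #{b ∈ Pᶜ | F.Adj a b} := by
  have hcard : #(P \ A) < #(A \ P) := by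
    have := card_sdiff_add_card_inter A P
    have := card_sdiff_add_card_inter P A
    rw [inter_comm] at this
    omega
  have hdeg' : ∀ a ∈ A \ P, 2 ≤ #{b ∈ P \ A | F.Adj a b} + #{b ∈ Pᶜ | F.Adj a b} := by
    intro a ha
    rw [Finset.mem_sdiff] at ha
    refine (hdeg a ha.1).trans ?_
    rw [← card_neighborFinset_eq_degree]
    refine (card_le_card fun b hb => ?_).trans (card_union_le _ _)
    have hab := (F.mem_neighborFinset a b).1 hb
    have := hA a ha.1 b hab
    simp [hab, this, em]
  have hsum := sum_le_sum hdeg'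
  rw [sum_add_distrib, sum_const, smul_eq_mul] at hsum
  have := sum_card_adj_lt_of_isAcyclic hF (S := A \ P) (T := P \ A)
    (disjoint_sdiff_sdiff) (card_pos.1 (by omega))
  omega

theorem splitGraph_one_adj {n q : ℕ} {i j : Fin n} : (splitGraph n q 1).Adj i j ↔
    i ≠ j ∧ (((i : ℕ) < q ∨ (i : ℕ) = q ∧ (j : ℕ) = q + 1) ∨
      ((j : ℕ) < q ∨ (j : ℕ) = q ∧ (i : ℕ) = q + 1)) := by
  simp [splitGraph, fromRel_adj]

theorem free_splitGraph_one [DecidableRel F.Adj] (hF : F.IsAcyclic) {A : Finset V}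
    (hA : ∀ a ∈ A, ∀ b, F.Adj a b → b ∉ A) (hdeg : ∀ a ∈ A, 2 ≤ F.degree a) {q : ℕ}
    (hq : q < #A) (n : ℕ) : F.Free (splitGraph n q 1) := by
  classical
  rintro ⟨f⟩
  have hinj {a b : V} (h : (f a : ℕ) = f b) : a = b := f.injective (Fin.ext h)
  let P : Finset V := {v | (f v : ℕ) < q}
  have hP : #P ≤ q := by
    rw [← card_range q]
    exact card_le_card_of_injOn (fun v => (f v : ℕ)) (fun v hv => by simpa [P] using hv)
      fun a _ b _ => hinj
  have htwo := two_le_sum_card_adj_sdiff hF hA hdeg (hP.trans_lt hq)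
  have hedge {a b : V} (ha : a ∉ P) (hb : b ∉ P) (hab : F.Adj a b) :
      (f a : ℕ) = q ∧ (f b : ℕ) = q + 1 ∨ (f a : ℕ) = q + 1 ∧ (f b : ℕ) = q := by
    have hadj := (splitGraph_one_adj.1 (f.toHom.map_adj hab)).2
    simp only [P, mem_filter_univ] at ha hb
    change (_ ∨ (f a : ℕ) = q ∧ (f b : ℕ) = q + 1) ∨
      (_ ∨ (f b : ℕ) = q ∧ (f a : ℕ) = q + 1) at hadj
    tauto
  have hone : ∑ a ∈ A \ P, #{b ∈ Pᶜ | F.Adj a b} ≤ 1 := by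
    have hpairs : ∑ a ∈ A \ P, #{b ∈ Pᶜ | F.Adj a b} =
        #{p ∈ (A \ P) ×ˢ Pᶜ | F.Adj p.1 p.2} := by simp only [card_filter, sum_product]
    rw [hpairs, card_le_one]
    simp only [mem_filter, mem_product, Finset.mem_sdiff, mem_compl]
    rintro ⟨a, b⟩ ⟨⟨⟨haA, haP⟩, hbP⟩, hab⟩ ⟨a', b'⟩ ⟨⟨⟨haA', haP'⟩, hbP'⟩, hab'⟩
    have hne : (f a : ℕ) ≠ f b' := fun h => hA a' haA' b' hab' (hinj h ▸ haA)
    have := hedge (a := a) (b := b) haP hbP hab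
    have := hedge (a := a') (b := b') haP' hbP' hab'
    obtain rfl : a = a' := hinj (by omega)
    obtain rfl : b = b' := hinj (by omega)
    rfl
  omega

theorem lt_graphRho_splitGraph_one {n q : ℕ} (hq : 1 ≤ q) (hn : q < n) :
    ((q : ℝ) - 1) / 2 + √((q : ℝ) * n - (3 * (q : ℝ) ^ 2 + 2 * q + 1) / 4) <
      graphRho (splitGraph n q 1) := by
  classical
  let L : Finset (Fin n) := {i | (i : ℕ) < q}
  have hcard : #L = q := by
    rw [Fin.card_filter_val_lt]
    omega
  have hL : IsDominatingClique (splitGraph n q 1) L := fun i hi j hij =>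
    splitGraph_one_adj.2 ⟨hij, .inl (.inl (mem_filter.1 hi).2)⟩
  have hle := matrixRho_matrixJ_le_graphRho hL (card_pos.1 (by omega)) (δ := 1)
    ((card_lt_iff_ne_univ L).1 (by simpa [hcard])) fun v _ => by omega
  rw [hcard, Fintype.card_fin] at hle
  exact (lt_matrixRho_matrixJ_one hq hn).trans_le hle

end SplitGraph

section DegenerateSums

variable {W : Type*} {G : SimpleGraph W} [DecidableRel G.Adj] {d : ℕ}

namespace IsDegenerate

theorem adjForm_le (hG : IsDegenerate G d) {x : W → ℝ} {c : ℝ} {S : Finset W}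
    (hx : ∀ v ∈ S, 0 ≤ x v) (hc : ∀ v ∈ S, x v ≤ c) :
    adjForm G x S ≤ 2 * (d * c * ∑ u ∈ S, x u) := by
  classical
  induction S using Finset.strongInduction with | H S ih
  rcases S.eq_empty_or_nonempty with rfl | hS
  · simp [adjForm]
  obtain ⟨v, hv, hvd⟩ := hG S hS
  have hrest := ih (S.erase v) (erase_ssubset hv) (fun u hu => hx u (mem_of_mem_erase hu))
    fun u hu => hc u (mem_of_mem_erase hu)
  have hrow : ∑ w ∈ S.erase v with G.Adj v w, x v * x w ≤ d * c * x v := by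
    have hsub : {w ∈ S.erase v | G.Adj v w} ⊆ {w ∈ S | G.Adj v w} :=
      filter_subset_filter _ (erase_subset v S)
    calc ∑ w ∈ S.erase v with G.Adj v w, x v * x w
        ≤ #{w ∈ S.erase v | G.Adj v w} • (x v * c) := sum_le_card_nsmul _ _ _ fun w hw =>
          mul_le_mul_of_nonneg_left (hc w (mem_filter.1 (hsub hw)).1) (hx v hv)
      _ ≤ d • (x v * c) := nsmul_le_nsmul_left
          (mul_nonneg (hx v hv) ((hx v hv).trans (hc v hv))) ((card_le_card hsub).trans hvd)
      _ = d * c * x v := by rw [nsmul_eq_mul]; ring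
  have hsingle : adjForm G x {v} = 0 := by simp [adjForm, filter_singleton]
  rw [← insert_erase hv, insert_eq, union_comm, adjForm_union _ _ (by simp), hsingle,
    sum_singleton, union_comm, ← insert_eq, sum_insert (notMem_erase v S)]
  linarith

theorem sum_card_adj_le (hG : IsDegenerate G d) (S : Finset W) :
    ∑ u ∈ S, (#{w ∈ S | G.Adj u w} : ℝ) ≤ 2 * (d * #S) := by
  simpa [adjForm] using
    hG.adjForm_le (x := fun _ => 1) (S := S) (fun _ _ => zero_le_one) fun _ _ => le_rfl

variable [Fintype W]

theorem sum_degree_le (hG : IsDegenerate G d) :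
    ∑ u, (G.degree u : ℝ) ≤ 2 * (d * Fintype.card W) := by
  simpa only [← neighborFinset_eq_filter, card_neighborFinset_eq_degree, card_univ] using
    hG.sum_card_adj_le univ

theorem card_mul_le_of_le_degree (hG : IsDegenerate G d) {S : Finset W} {D : ℝ}
    (hS : ∀ v ∈ S, D ≤ G.degree v) : #S * D ≤ 2 * (d * Fintype.card W) := by
  rw [← nsmul_eq_mul]
  exact (card_nsmul_le_sum S _ D hS).trans
    ((sum_le_univ_sum_of_nonneg fun v => by positivity).trans hG.sum_degree_le)

end IsDegenerate

end DegenerateSums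

section JoinSparse

variable {W : Type*} [Fintype W] {G : SimpleGraph W} [DecidableRel G.Adj] {q d δ : ℕ}

/-- The vertices of `G` adjacent to every vertex of `L`. -/
def commonNbr (G : SimpleGraph W) [DecidableRel G.Adj] (L : Finset W) : Finset W :=
  {w | ∀ u ∈ L, G.Adj u w}

theorem mem_commonNbr {L : Finset W} {w : W} : w ∈ commonNbr G L ↔ ∀ u ∈ L, G.Adj u w :=
  mem_filter_univ w

theorem notMem_of_mem_commonNbr {L : Finset W} {w : W} (hw : w ∈ commonNbr G L) : w ∉ L :=
  fun h => (mem_commonNbr.1 hw w h).ne rfl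

/-- Whenever `q` vertices have at least `d` common neighbours, every further vertex is adjacent to
fewer than `δ` of these. Besides degeneracy, this is what the upper bound extracts from
`F`-freeness. -/
def IsJoinSparse (G : SimpleGraph W) [DecidableRel G.Adj] (q d δ : ℕ) : Prop :=
  ∀ L : Finset W, #L = q → d ≤ #(commonNbr G L) → ∀ v ∉ L, #{w ∈ commonNbr G L | G.Adj v w} < δ

theorem isJoinSparse_of_free {V : Type*} [Fintype V] {F : SimpleGraph V} [DecidableRel F.Adj]
    {A B : Finset V} (hAB : F.IsBipartiteWith A B) (hA : #A ≤ q + 1) {a₀ : V} (ha₀ : a₀ ∈ A)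
    (hG : F.Free G) : IsJoinSparse G q (Fintype.card V) (F.degree a₀) := by
  rintro L rfl hd v hv
  by_contra! hδ
  exact hG (isContained_of_forall_adj hAB (fun u hu w hw => mem_commonNbr.1 hw u hu) hA hd ha₀
    hv hδ)

theorem IsJoinSparse.card_lt_card_adj_le (hG : IsJoinSparse G q d δ) (hδ : δ ≤ d)
    (S : Finset W) : #{u | q < #{w ∈ S | G.Adj u w}} ≤ (#S).choose (q + 1) * d := by
  classical
  have hcommon (T : Finset W) (hT : #T = q + 1) : #(commonNbr G T) ≤ d := by
    by_contra! h
    obtain ⟨v, hv⟩ : T.Nonempty := card_pos.1 (by omega)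
    have hsub : commonNbr G T ⊆ {w ∈ commonNbr G (T.erase v) | G.Adj v w} := fun w hw =>
      mem_filter.2 ⟨mem_commonNbr.2 fun u hu => mem_commonNbr.1 hw u (mem_of_mem_erase hu),
        mem_commonNbr.1 hw v hv⟩
    have hle := card_le_card hsub
    have hlt := hG (T.erase v) (by rw [card_erase_of_mem hv, hT]; rfl)
      (h.le.trans (hle.trans (card_filter_le _ _))) v (notMem_erase v T)
    omega
  have hcover : ({u | q < #{w ∈ S | G.Adj u w}} : Finset W) ⊆
      (S.powersetCard (q + 1)).biUnion (commonNbr G) := by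
    intro u hu
    obtain ⟨T, hTS, hT⟩ := exists_subset_card_eq (Nat.succ_le_of_lt ((mem_filter_univ u).1 hu))
    exact mem_biUnion.2 ⟨T, mem_powersetCard.2 ⟨hTS.trans (filter_subset _ _), hT⟩,
      mem_commonNbr.2 fun w hw => ((mem_filter.1 (hTS hw)).2).symm⟩
  refine (card_le_card hcover).trans ?_
  rw [← card_powersetCard]
  exact card_biUnion_le_card_mul _ _ _ fun T hT => hcommon T (mem_powersetCard.1 hT).2

end JoinSparse

section HeavyVertices

variable {W : Type*} [Fintype W] {G : SimpleGraph W} [DecidableRel G.Adj] {d : ℕ} {x : W → ℝ}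

/-- The vertices whose weight under `x` exceeds `t`. -/
noncomputable def heavy (x : W → ℝ) (t : ℝ) : Finset W := {w | t < x w}

/-- The total weight under `x` of the neighbours of `u` whose weight exceeds `t`. -/
noncomputable def heavyNbrWeight (G : SimpleGraph W) [DecidableRel G.Adj] (x : W → ℝ) (t : ℝ)
    (u : W) : ℝ :=
  ∑ w ∈ heavy x t with G.Adj u w, x w

theorem mem_heavy {t : ℝ} {w : W} : w ∈ heavy x t ↔ t < x w := mem_filter_univ w

theorem sum_neighborFinset_le_add_heavyNbrWeight {t : ℝ} (ht : 0 ≤ t) (u : W) :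
    ∑ w ∈ G.neighborFinset u, x w ≤ t * G.degree u + heavyNbrWeight G x t u := by
  have hheavy : {w ∈ G.neighborFinset u | t < x w} = {w ∈ heavy x t | G.Adj u w} := by
    ext w
    simp [heavy, and_comm]
  have hlight : ∑ w ∈ G.neighborFinset u with ¬ t < x w, x w ≤ t * G.degree u := by
    calc ∑ w ∈ G.neighborFinset u with ¬ t < x w, x w
        ≤ #{w ∈ G.neighborFinset u | ¬ t < x w} • t :=
          sum_le_card_nsmul _ _ _ fun w hw => not_lt.1 (mem_filter.1 hw).2
      _ ≤ G.degree u • t := nsmul_le_nsmul_left ht (card_filter_le _ _)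
      _ = t * G.degree u := by rw [nsmul_eq_mul, mul_comm]
  rw [← sum_filter_not_add_sum_filter (G.neighborFinset u) (t < x ·), hheavy]
  exact add_le_add_left hlight _

namespace IsPerronVector

theorem graphRho_mul_le_degree (hx : IsPerronVector G x) (v : W) :
    graphRho G * x v ≤ G.degree v := by
  rw [hx.graphRho_mul, ← card_neighborFinset_eq_degree, ← nsmul_one]
  exact sum_le_card_nsmul _ _ _ fun w _ => hx.le_one w

theorem heavyNbrWeight_le_card (hx : IsPerronVector G x) (t : ℝ) (u : W) :
    heavyNbrWeight G x t u ≤ #{w ∈ heavy x t | G.Adj u w} := by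
  rw [← nsmul_one]
  exact sum_le_card_nsmul _ _ _ fun w _ => hx.le_one w

theorem sq_graphRho_mul_le (hx : IsPerronVector G x) (hG : IsDegenerate G d) {t : ℝ} (ht : 0 ≤ t)
    (v : W) :
    graphRho G ^ 2 * x v ≤
      2 * d * t * Fintype.card W + ∑ u ∈ G.neighborFinset v, heavyNbrWeight G x t u := by
  have hdeg : ∑ u ∈ G.neighborFinset v, t * (G.degree u : ℝ) ≤ 2 * d * t * Fintype.card W := by
    calc ∑ u ∈ G.neighborFinset v, t * (G.degree u : ℝ) ≤ ∑ u, t * (G.degree u : ℝ) :=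
          sum_le_univ_sum_of_nonneg fun u => by positivity
      _ ≤ t * (2 * (d * Fintype.card W)) := by
          rw [← mul_sum]
          exact mul_le_mul_of_nonneg_left hG.sum_degree_le ht
      _ = 2 * d * t * Fintype.card W := by ring
  calc graphRho G ^ 2 * x v = ∑ u ∈ G.neighborFinset v, ∑ w ∈ G.neighborFinset u, x w := by
        rw [pow_two, mul_assoc, hx.graphRho_mul, mul_sum]
        exact sum_congr rfl fun u _ => hx.graphRho_mul u
    _ ≤ ∑ u ∈ G.neighborFinset v, (t * G.degree u + heavyNbrWeight G x t u) :=
        sum_le_sum fun u _ => sum_neighborFinset_le_add_heavyNbrWeight ht u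
    _ ≤ 2 * d * t * Fintype.card W + ∑ u ∈ G.neighborFinset v, heavyNbrWeight G x t u := by
        rw [sum_add_distrib]
        exact add_le_add_left hdeg _

theorem sum_heavyNbrWeight_le (hx : IsPerronVector G x) (hG : IsDegenerate G d) (t : ℝ)
    (S : Finset W) :
    ∑ u ∈ S, heavyNbrWeight G x t u ≤ 2 * (d * (#S + #(heavy x t))) := by
  classical
  calc ∑ u ∈ S, heavyNbrWeight G x t u ≤ ∑ u ∈ S, (#{w ∈ heavy x t | G.Adj u w} : ℝ) :=
        sum_le_sum fun u _ => hx.heavyNbrWeight_le_card t u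
    _ ≤ ∑ u ∈ S ∪ heavy x t, (#{w ∈ heavy x t | G.Adj u w} : ℝ) :=
        sum_le_sum_of_subset_of_nonneg subset_union_left fun u _ _ => by positivity
    _ ≤ ∑ u ∈ S ∪ heavy x t, (#{w ∈ S ∪ heavy x t | G.Adj u w} : ℝ) := by
        gcongr
        exact subset_union_right
    _ ≤ 2 * (d * #(S ∪ heavy x t)) := hG.sum_card_adj_le _
    _ ≤ 2 * (d * (#S + #(heavy x t))) := by
        gcongr
        exact_mod_cast card_union_le _ _

theorem card_heavy_mul_le_sqrt (hx : IsPerronVector G x) (hG : IsDegenerate G d) {t : ℝ}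
    (ht : 0 ≤ t) (hρ : √(Fintype.card W : ℝ) ≤ graphRho G) :
    #(heavy x t) * t ≤ 2 * d * √(Fintype.card W : ℝ) := by
  obtain ⟨z, -⟩ := hx.exists_eq_one
  have hn : 0 < √(Fintype.card W : ℝ) :=
    Real.sqrt_pos.2 (Nat.cast_pos.2 (Fintype.card_pos_iff.2 ⟨z⟩))
  have hcard : #(heavy x t) * (√(Fintype.card W : ℝ) * t) ≤ 2 * (d * Fintype.card W) :=
    hG.card_mul_le_of_le_degree fun v hv =>
      (mul_le_mul hρ (mem_heavy.1 hv).le ht (hn.le.trans hρ)).trans (hx.graphRho_mul_le_degree v)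
  have hsqrt := Real.mul_self_sqrt (Nat.cast_nonneg (α := ℝ) (Fintype.card W))
  refine le_of_mul_le_mul_right ?_ hn
  linear_combination hcard - 2 * d * hsqrt

theorem mul_card_le_mul_degree (hx : IsPerronVector G x) (hG : IsDegenerate G d) (hd : 0 < d)
    {η : ℝ} (hη : 0 < η) (hρ : √(Fintype.card W : ℝ) ≤ graphRho G)
    (hn : 64 * (d : ℝ) ^ 3 ≤ η ^ 2 * √(Fintype.card W : ℝ)) {v : W} (hv : η ≤ x v) :
    η * Fintype.card W ≤ 8 * d * G.degree v := by
  have : (0 : ℝ) < d := Nat.cast_pos.2 hd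
  obtain ⟨t, ht, htη⟩ : ∃ t : ℝ, 0 < t ∧ 4 * d * t = η :=
    ⟨η / (4 * d), by positivity, mul_div_cancel₀ _ (by positivity)⟩
  have hsqrt := Real.mul_self_sqrt (Nat.cast_nonneg (α := ℝ) (Fintype.card W))
  set n := (Fintype.card W : ℝ)
  have hheavy : 8 * (d * #(heavy x t)) ≤ η * n := by
    refine le_of_mul_le_mul_right ?_ hη
    calc 8 * (d * #(heavy x t)) * η = 32 * d ^ 2 * (#(heavy x t) * t) := by rw [← htη]; ring
      _ ≤ 32 * d ^ 2 * (2 * d * √n) :=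
          mul_le_mul_of_nonneg_left (hx.card_heavy_mul_le_sqrt hG ht.le hρ) (by positivity)
      _ = 64 * d ^ 3 * √n := by ring
      _ ≤ η ^ 2 * √n * √n := mul_le_mul_of_nonneg_right hn (Real.sqrt_nonneg n)
      _ = η * n * η := by rw [mul_assoc, hsqrt]; ring
  have hsq : n * η ≤ graphRho G ^ 2 * x v :=
    mul_le_mul (Real.sqrt_le_iff.1 hρ).2 hv hη.le (sq_nonneg _)
  have htwo := hx.sq_graphRho_mul_le hG ht.le v
  have hnbr := hx.sum_heavyNbrWeight_le hG t (G.neighborFinset v)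
  rw [card_neighborFinset_eq_degree] at hnbr
  linear_combination 4 * hsq + 4 * htwo + 4 * hnbr + hheavy + 2 * n * htη

theorem card_heavy_mul_le (hx : IsPerronVector G x) (hG : IsDegenerate G d) (hd : 0 < d) {η : ℝ}
    (hη : 0 < η) (hρ : √(Fintype.card W : ℝ) ≤ graphRho G)
    (hn : 64 * (d : ℝ) ^ 3 ≤ η ^ 2 * √(Fintype.card W : ℝ)) :
    #(heavy x η) * η ≤ 16 * d ^ 2 := by
  obtain ⟨z, -⟩ := hx.exists_eq_one
  have hn0 : (0 : ℝ) < Fintype.card W := Nat.cast_pos.2 (Fintype.card_pos_iff.2 ⟨z⟩)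
  have : (0 : ℝ) < d := Nat.cast_pos.2 hd
  have hcard : #(heavy x η) * (η * Fintype.card W / (8 * d)) ≤ 2 * (d * Fintype.card W) :=
    hG.card_mul_le_of_le_degree fun v hv => (div_le_iff₀' (by positivity)).2
      (hx.mul_card_le_mul_degree hG hd hη hρ hn (mem_heavy.1 hv).le)
  rw [← mul_div_assoc, div_le_iff₀ (by positivity)] at hcard
  refine le_of_mul_le_mul_right ?_ hn0
  linear_combination hcard

end IsPerronVector

end HeavyVertices

section DominatingSet

variable {W : Type*} [Fintype W] {G : SimpleGraph W} [DecidableRel G.Adj] {q d δ : ℕ} {x : W → ℝ}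
  {η : ℝ}

theorem card_compl_commonNbr_le [DecidableEq W] {L : Finset W} {D : ℝ}
    (hD : ∀ u ∈ L, (Fintype.card W : ℝ) ≤ G.degree u + D) :
    (#(commonNbr G L)ᶜ : ℝ) ≤ #L * D := by
  have hcover : (commonNbr G L)ᶜ ⊆ L.biUnion fun u => (G.neighborFinset u)ᶜ := by
    intro w hw
    simpa [mem_commonNbr] using hw
  calc (#(commonNbr G L)ᶜ : ℝ) ≤ ∑ u ∈ L, (#(G.neighborFinset u)ᶜ : ℝ) := by
        exact_mod_cast (card_le_card hcover).trans card_biUnion_le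
    _ ≤ #L • D := sum_le_card_nsmul _ _ _ fun u hu => by
        rw [card_compl, card_neighborFinset_eq_degree, Nat.cast_sub (G.degree_lt_card_verts u).le]
        linarith [hD u hu]
    _ = #L * D := nsmul_eq_mul _ _

theorem degree_le_card_add_card_compl [DecidableEq W] (S : Finset W) (v : W) :
    G.degree v ≤ #{w ∈ S | G.Adj v w} + #Sᶜ := by
  rw [← card_neighborFinset_eq_degree, neighborFinset_eq_filter,
    ← card_filter_add_card_filter_not (s := {w | G.Adj v w}) (· ∈ S)]
  refine add_le_add (card_le_card fun w hw => ?_) (card_le_card fun w hw => ?_)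
  · simp_all
  · simp_all

/-- The vertices having more than `q` neighbours whose weight under `x` exceeds `t`. -/
noncomputable def crowded (G : SimpleGraph W) [DecidableRel G.Adj] (x : W → ℝ) (t : ℝ) (q : ℕ) :
    Finset W :=
  {u | q < #{w ∈ heavy x t | G.Adj u w}}

theorem card_le_of_notMem_crowded {t : ℝ} {u : W} (hu : u ∉ crowded G x t q) :
    #{w ∈ heavy x t | G.Adj u w} ≤ q := by
  simpa [crowded] using hu

theorem IsJoinSparse.card_crowded_mul_card_heavy_le (hG : IsJoinSparse G q d δ) (hδ : δ ≤ d)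
    {C : ℕ} (hC : #(heavy x η) ≤ C) (hn : (2 : ℝ) ^ C * C ≤ η * Fintype.card W) :
    (#(crowded G x η q) : ℝ) * #(heavy x η) ≤ d * η * Fintype.card W := by
  have hcrowded : #(crowded G x η q) ≤ 2 ^ C * d :=
    (hG.card_lt_card_adj_le hδ _).trans <| Nat.mul_le_mul_right d <|
      (Nat.choose_le_two_pow _ _).trans (Nat.pow_le_pow_right two_pos hC)
  calc (#(crowded G x η q) : ℝ) * #(heavy x η) ≤ 2 ^ C * d * C := by
        exact_mod_cast Nat.mul_le_mul hcrowded hC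
    _ = d * (2 ^ C * C) := by ring
    _ ≤ d * η * Fintype.card W := by
        rw [mul_assoc]
        exact mul_le_mul_of_nonneg_left hn (Nat.cast_nonneg d)

namespace IsPerronVector

theorem heavyNbrWeight_le_of_notMem_crowded (hx : IsPerronVector G x) {u : W}
    (hu : u ∉ crowded G x η q) : heavyNbrWeight G x η u ≤ q :=
  (hx.heavyNbrWeight_le_card η u).trans (Nat.cast_le.2 (card_le_of_notMem_crowded hu))

theorem mul_card_mul_le_add_sum_sdiff [DecidableEq W] (hx : IsPerronVector G x)
    (hG : IsDegenerate G d) (hη : 0 ≤ η) (hρ : √((q : ℝ) * Fintype.card W) ≤ graphRho G)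
    {X : Finset W} (hX : (#X : ℝ) * #(heavy x η) ≤ d * η * Fintype.card W) (v : W) :
    q * Fintype.card W * x v ≤ 3 * (d * η) * Fintype.card W +
      ∑ u ∈ G.neighborFinset v \ X, heavyNbrWeight G x η u := by
  have hX' : ∑ u ∈ G.neighborFinset v ∩ X, heavyNbrWeight G x η u ≤ d * η * Fintype.card W := by
    calc ∑ u ∈ G.neighborFinset v ∩ X, heavyNbrWeight G x η u
        ≤ #(G.neighborFinset v ∩ X) • (#(heavy x η) : ℝ) := sum_le_card_nsmul _ _ _ fun u _ =>
          (hx.heavyNbrWeight_le_card η u).trans (Nat.cast_le.2 (card_filter_le _ _))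
      _ ≤ #X • (#(heavy x η) : ℝ) :=
          nsmul_le_nsmul_left (Nat.cast_nonneg _) (card_le_card inter_subset_right)
      _ ≤ d * η * Fintype.card W := by rwa [nsmul_eq_mul]
  have hsq : q * Fintype.card W * x v ≤ graphRho G ^ 2 * x v :=
    mul_le_mul_of_nonneg_right (Real.sqrt_le_iff.1 hρ).2 (hx.nonneg v)
  have htwo := hx.sq_graphRho_mul_le hG hη v
  rw [← sum_inter_add_sum_sdiff (G.neighborFinset v) X] at htwo
  linear_combination hsq + htwo + hX'

theorem card_mul_le_add_degree (hx : IsPerronVector G x) (hG : IsDegenerate G d) (hη : 0 ≤ η)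
    (hq : 1 ≤ q) (hρ : √((q : ℝ) * Fintype.card W) ≤ graphRho G)
    (hX : (#(crowded G x η q) : ℝ) * #(heavy x η) ≤ d * η * Fintype.card W) (v : W) :
    Fintype.card W * x v ≤ 3 * (d * η) * Fintype.card W + G.degree v := by
  classical
  have hq' : (1 : ℝ) ≤ q := Nat.one_le_cast.2 hq
  have hsum : ∑ u ∈ G.neighborFinset v \ crowded G x η q, heavyNbrWeight G x η u ≤
      q * G.degree v := by
    calc ∑ u ∈ G.neighborFinset v \ crowded G x η q, heavyNbrWeight G x η u
        ≤ #(G.neighborFinset v \ crowded G x η q) • (q : ℝ) := sum_le_card_nsmul _ _ _ fun u hu =>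
          hx.heavyNbrWeight_le_of_notMem_crowded (Finset.mem_sdiff.1 hu).2
      _ ≤ G.degree v • (q : ℝ) :=
          nsmul_le_nsmul_left (Nat.cast_nonneg q) (card_le_card sdiff_subset)
      _ = q * G.degree v := by rw [nsmul_eq_mul, mul_comm]
  have hmain := hx.mul_card_mul_le_add_sum_sdiff hG hη hρ hX v
  have hle : 3 * (d * η) * Fintype.card W ≤ q * (3 * (d * η) * Fintype.card W) :=
    le_mul_of_one_le_left (by positivity) hq'
  refine le_of_mul_le_mul_left ?_ (zero_lt_one.trans_le hq')
  linear_combination hmain + hsum + hle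

theorem exists_notMem_lt_heavyNbrWeight (hx : IsPerronVector G x) (hG : IsDegenerate G d)
    (hd : 0 < d) (hη : 0 < η) (hηq : 4 * (d * η) ≤ q)
    (hρ : √((q : ℝ) * Fintype.card W) ≤ graphRho G) {X : Finset W}
    (hX : (#X : ℝ) * #(heavy x η) ≤ d * η * Fintype.card W) :
    ∃ u ∉ X, q - 4 * (d * η) < heavyNbrWeight G x η u := by
  classical
  by_contra! hle
  obtain ⟨z, hz⟩ := hx.exists_eq_one
  have hn : (0 : ℝ) < Fintype.card W := Nat.cast_pos.2 (Fintype.card_pos_iff.2 ⟨z⟩)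
  have hmain := hx.mul_card_mul_le_add_sum_sdiff hG hη.le hρ hX z
  have hsum : ∑ u ∈ G.neighborFinset z \ X, heavyNbrWeight G x η u ≤
      Fintype.card W * (q - 4 * (d * η)) := by
    rw [← nsmul_eq_mul]
    exact (sum_le_card_nsmul _ _ _ fun u hu => hle u (Finset.mem_sdiff.1 hu).2).trans
      (nsmul_le_nsmul_left (sub_nonneg.2 hηq) (card_le_univ _))
  have : 0 < d * η * Fintype.card W := by positivity
  rw [hz] at hmain
  linarith

theorem exists_card_eq_one_sub_le (hx : IsPerronVector G x) (hG : IsDegenerate G d) (hd : 0 < d)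
    (hη : 0 < η) (hηd : 4 * (d * η) ≤ 1) (hq : 1 ≤ q)
    (hρ : √((q : ℝ) * Fintype.card W) ≤ graphRho G)
    (hX : (#(crowded G x η q) : ℝ) * #(heavy x η) ≤ d * η * Fintype.card W) :
    ∃ L : Finset W, #L = q ∧ ∀ w ∈ L, 1 - 4 * (d * η) ≤ x w := by
  classical
  have hq' : (1 : ℝ) ≤ q := Nat.one_le_cast.2 hq
  obtain ⟨u, hu, hlt⟩ := hx.exists_notMem_lt_heavyNbrWeight hG hd hη (hηd.trans hq') hρ hX
  have hcard : #{w ∈ heavy x η | G.Adj u w} = q := by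
    refine le_antisymm (card_le_of_notMem_crowded hu) (Nat.lt_succ_iff.1 ?_)
    have := hx.heavyNbrWeight_le_card η u
    exact_mod_cast (by linarith : (q : ℝ) < #{w ∈ heavy x η | G.Adj u w} + 1)
  refine ⟨_, hcard, fun w hw => ?_⟩
  have hrest : ∑ w ∈ {w ∈ heavy x η | G.Adj u w}.erase w, x w ≤ q - 1 := by
    refine (sum_le_card_nsmul _ _ _ fun w _ => hx.le_one w).trans_eq ?_
    rw [card_erase_of_mem hw, hcard, nsmul_one, Nat.cast_sub hq, Nat.cast_one]
  rw [heavyNbrWeight, ← add_sum_erase _ _ hw] at hlt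
  linarith

theorem exists_dominating (hx : IsPerronVector G x) (hG : IsDegenerate G d)
    (hGq : IsJoinSparse G q d δ) (hδ : δ ≤ d) (hq : 1 ≤ q) (hqd : q ≤ d) (hη : 0 < η)
    (hηd : 44 * (d ^ 2 * η) ≤ 1) (hn : 1 ≤ η * Fintype.card W)
    (hρ : √((q : ℝ) * Fintype.card W) ≤ graphRho G)
    (hX : (#(crowded G x η q) : ℝ) * #(heavy x η) ≤ d * η * Fintype.card W) :
    ∃ L : Finset W, #L = q ∧ (∀ v ∈ L, 1 / 2 ≤ x v) ∧ (∀ v ∉ L, x v ≤ 11 * (d ^ 2 * η)) ∧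
      d ≤ #(commonNbr G L) := by
  classical
  have hd' : (1 : ℝ) ≤ d := Nat.one_le_cast.2 (hq.trans hqd)
  have hdd : d * η ≤ d ^ 2 * η := mul_le_mul_of_nonneg_right (le_self_pow₀ hd' two_ne_zero) hη.le
  obtain ⟨L, rfl, hL⟩ := hx.exists_card_eq_one_sub_le hG (hq.trans hqd) hη (by linarith) hq hρ hX
  have hdeg := hx.card_mul_le_add_degree hG hη.le hq hρ hX
  set n := (Fintype.card W : ℝ)
  have hn0 : 0 < n := pos_of_mul_pos_right (one_pos.trans_le hn) hη.le
  have hcompl : (#(commonNbr G L)ᶜ : ℝ) ≤ 7 * (d ^ 2 * η * n) := by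
    calc (#(commonNbr G L)ᶜ : ℝ) ≤ #L * (7 * (d * η * n)) :=
          card_compl_commonNbr_le fun u hu => by
            linear_combination hdeg u + n * hL u hu
      _ ≤ d * (7 * (d * η * n)) :=
          mul_le_mul_of_nonneg_right (Nat.cast_le.2 hqd) (by positivity)
      _ = 7 * (d ^ 2 * η * n) := by ring
  have hdn : (d : ℝ) ≤ d ^ 2 * η * n := by
    calc (d : ℝ) ≤ d ^ 2 * 1 := by rw [mul_one]; exact le_self_pow₀ hd' two_ne_zero
      _ ≤ d ^ 2 * (η * n) := mul_le_mul_of_nonneg_left hn (by positivity)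
      _ = d ^ 2 * η * n := by ring
  have hcommon : d ≤ #(commonNbr G L) := by
    have hsum : (#(commonNbr G L) + #(commonNbr G L)ᶜ : ℝ) = n := by
      rw [← Nat.cast_add, card_add_card_compl]
    suffices (d : ℝ) ≤ #(commonNbr G L) from Nat.cast_le.1 this
    have hpos : 0 ≤ d ^ 2 * η * n := by positivity
    linear_combination hdn + hcompl - hsum + n * hηd + 36 * hpos
  refine ⟨L, rfl, fun v hv => by linarith [hL v hv], fun v hv => ?_, hcommon⟩
  have hdegv : (G.degree v : ℝ) ≤ d + #(commonNbr G L)ᶜ := by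
    have := degree_le_card_add_card_compl (G := G) (commonNbr G L) v
    have := hGq L rfl hcommon v hv
    exact_mod_cast (by omega : G.degree v ≤ d + #(commonNbr G L)ᶜ)
  refine le_of_mul_le_mul_left ?_ hn0
  linear_combination hdeg v + hdegv + hcompl + hdn + 3 * n * hdd

end IsPerronVector

end DominatingSet

section Rejoin

variable {W : Type*} {G : SimpleGraph W} [DecidableRel G.Adj]

theorem adjForm_nonneg {x : W → ℝ} (hx : ∀ v, 0 ≤ x v) (S : Finset W) : 0 ≤ adjForm G x S :=
  sum_nonneg fun u _ => sum_nonneg fun w _ => mul_nonneg (hx u) (hx w)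

variable [Fintype W] {L : Finset W} {x : W → ℝ} {c : ℝ} {δ d : ℕ}

/-- The graph obtained from `G` by joining every vertex of `L` to all other vertices and keeping,
outside `L`, only the edges between common neighbours of `L`. -/
def rejoin (G : SimpleGraph W) [DecidableRel G.Adj] (L : Finset W) : SimpleGraph W where
  Adj u w := u ≠ w ∧ (u ∈ L ∨ w ∈ L ∨ u ∈ commonNbr G L ∧ w ∈ commonNbr G L ∧ G.Adj u w)
  symm := ⟨fun u w h => ⟨h.1.symm, by grind [G.adj_comm u w]⟩⟩
  loopless := ⟨fun _ h => h.1 rfl⟩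

theorem isDominatingClique_rejoin : IsDominatingClique (rejoin G L) L :=
  fun _ hu _ huv => ⟨huv, .inl hu⟩

theorem sum_commonNbr_adj_le (hc : ∀ v ∉ L, x v ≤ c) (hc0 : 0 ≤ c) {u : W}
    (hδ : #{w ∈ commonNbr G L | G.Adj u w} < δ) :
    ∑ w ∈ commonNbr G L with G.Adj u w, x w ≤ δ * c := by
  rw [← nsmul_eq_mul]
  exact (sum_le_card_nsmul _ _ _ fun w hw =>
    hc w (notMem_of_mem_commonNbr (mem_filter.1 hw).1)).trans (nsmul_le_nsmul_left hc0 hδ.le)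

theorem sum_adj_add_half_le (hx : ∀ v, 0 ≤ x v) (hL : ∀ v ∈ L, 1 / 2 ≤ x v) {u : W}
    (hu : u ∉ commonNbr G L) : ∑ w ∈ L with G.Adj u w, x w + 1 / 2 ≤ ∑ w ∈ L, x w := by
  obtain ⟨l, hl, hul⟩ : ∃ l ∈ L, ¬ G.Adj u l := by
    simpa [mem_commonNbr, G.adj_comm] using hu
  rw [← sum_filter_add_sum_filter_not L (G.Adj u) x]
  gcongr
  exact (hL l hl).trans (single_le_sum (f := x) (fun w _ => hx w) (mem_filter.2 ⟨hl, hul⟩))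

theorem sum_joined_adj_le [DecidableEq W] [DecidableRel (rejoin G L).Adj] (hx : ∀ v, 0 ≤ x v)
    (hL : ∀ v ∈ L, 1 / 2 ≤ x v) (hc : ∀ v ∉ L, x v ≤ c) (hc0 : 0 ≤ c)
    (hδ : ∀ v ∉ L, #{w ∈ commonNbr G L | G.Adj v w} < δ) {u : W} (hu : u ∉ L ∪ commonNbr G L) :
    ∑ w ∈ L ∪ commonNbr G L with G.Adj u w, x u * x w + x u * (1 / 2 - δ * c) ≤
      ∑ w ∈ L ∪ commonNbr G L with (rejoin G L).Adj u w, x u * x w := by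
  obtain ⟨huL, huN⟩ := notMem_union.1 hu
  have hdisj : Disjoint L (commonNbr G L) :=
    Finset.disjoint_right.2 fun w => notMem_of_mem_commonNbr
  have hsub : L ⊆ {w ∈ L ∪ commonNbr G L | (rejoin G L).Adj u w} := fun w hw =>
    mem_filter.2 ⟨mem_union_left _ hw, fun h => huL (h ▸ hw), .inr (.inl hw)⟩
  rw [← mul_sum, ← mul_sum, ← mul_add]
  refine mul_le_mul_of_nonneg_left ?_ (hx u)
  refine le_trans ?_ (sum_le_sum_of_subset_of_nonneg hsub fun w _ _ => hx w)
  rw [filter_union, sum_union (disjoint_filter_filter hdisj)]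
  linarith [sum_adj_add_half_le hx hL huN, sum_commonNbr_adj_le hc hc0 (hδ u huL)]

theorem adjForm_joined_le [DecidableEq W] [DecidableRel (rejoin G L).Adj] (hx : ∀ v, 0 ≤ x v) :
    adjForm G x (L ∪ commonNbr G L) ≤ adjForm (rejoin G L) x (L ∪ commonNbr G L) := by
  refine sum_le_sum fun u hu => sum_le_sum_of_subset_of_nonneg (fun w hw => ?_)
    fun w _ _ => mul_nonneg (hx u) (hx w)
  obtain ⟨hw, huw⟩ := mem_filter.1 hw
  refine mem_filter.2 ⟨hw, huw.ne, ?_⟩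
  rw [mem_union] at hu hw
  tauto

theorem adjForm_le_adjForm_rejoin [DecidableRel (rejoin G L).Adj] (hG : IsDegenerate G d)
    (hx : ∀ v, 0 ≤ x v) (hL : ∀ v ∈ L, 1 / 2 ≤ x v) (hc : ∀ v ∉ L, x v ≤ c) (hc0 : 0 ≤ c)
    (hδ : ∀ v ∉ L, #{w ∈ commonNbr G L | G.Adj v w} < δ) (hsmall : 2 * ((δ + d) * c) ≤ 1) :
    adjForm G x univ ≤ adjForm (rejoin G L) x univ := by
  classical
  set P := L ∪ commonNbr G L
  have hrest : adjForm G x Pᶜ ≤ 2 * (d * c * ∑ u ∈ Pᶜ, x u) :=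
    hG.adjForm_le (fun v _ => hx v) fun v hv =>
      hc v fun hvL => mem_compl.1 hv (mem_union_left _ hvL)
  have hcross : ∑ u ∈ Pᶜ, ∑ w ∈ P with G.Adj u w, x u * x w +
      (∑ u ∈ Pᶜ, x u) * (1 / 2 - δ * c) ≤
        ∑ u ∈ Pᶜ, ∑ w ∈ P with (rejoin G L).Adj u w, x u * x w := by
    rw [sum_mul, ← sum_add_distrib]
    exact sum_le_sum fun u hu => sum_joined_adj_le hx hL hc hc0 hδ (mem_compl.1 hu)
  have hgain : 0 ≤ (∑ u ∈ Pᶜ, x u) * (1 - 2 * ((δ + d) * c)) :=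
    mul_nonneg (sum_nonneg fun u _ => hx u) (sub_nonneg.2 hsmall)
  rw [← union_compl P, adjForm_union G x disjoint_compl_right,
    adjForm_union (rejoin G L) x disjoint_compl_right]
  linarith [adjForm_joined_le (G := G) (L := L) hx, adjForm_nonneg (G := rejoin G L) hx Pᶜ]

theorem graphRho_rejoin_le (hL0 : L.Nonempty) (hL1 : L ≠ univ)
    (hδ : ∀ v ∉ L, #{w ∈ commonNbr G L | G.Adj v w} < δ) :
    graphRho (rejoin G L) ≤ matrixRho (matrixJ (Fintype.card W) #L δ) := by
  classical
  refine graphRho_le_matrixRho_matrixJ isDominatingClique_rejoin hL0 hL1 fun v hv =>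
    (card_le_card fun w hw => ?_).trans_lt (hδ v hv)
  obtain ⟨hvw, hw⟩ := mem_filter.1 hw
  obtain ⟨-, h | h | h⟩ := (mem_neighborFinset _ _ _).1 hvw
  · exact absurd h hv
  · exact absurd h hw
  · exact mem_filter.2 h.2

end Rejoin

section Upper

variable {q d δ : ℕ}

theorem graphRho_le_of_isJoinSparse {W : Type*} [Fintype W] {G : SimpleGraph W}
    [DecidableRel G.Adj] (hG : IsDegenerate G d) (hGq : IsJoinSparse G q d δ) (hδ : δ ≤ d)
    (hq : 1 ≤ q) (hqd : q ≤ d) {η : ℝ} (hη : 0 < η) (hηd : 44 * (d ^ 3 * η) ≤ 1) {C : ℕ}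
    (hC : 16 * (d : ℝ) ^ 2 ≤ C * η) (hρ : √((q : ℝ) * Fintype.card W) ≤ graphRho G)
    (hn₁ : 1 ≤ η * Fintype.card W) (hn₂ : 64 * (d : ℝ) ^ 3 ≤ η ^ 2 * √(Fintype.card W : ℝ))
    (hn₃ : (2 : ℝ) ^ C * C ≤ η * Fintype.card W) :
    graphRho G ≤ matrixRho (matrixJ (Fintype.card W) q δ) := by
  classical
  have hd : 1 ≤ d := hq.trans hqd
  have hd' : (1 : ℝ) ≤ d := Nat.one_le_cast.2 hd
  have hn : (0 : ℝ) < Fintype.card W := pos_of_mul_pos_right (one_pos.trans_le hn₁) hη.le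
  have : Nonempty W := Fintype.card_pos_iff.1 (Nat.cast_pos.1 hn)
  obtain ⟨x, hx⟩ := exists_isPerronVector G
  have hρ₁ : √(Fintype.card W : ℝ) ≤ graphRho G :=
    (Real.sqrt_le_sqrt (le_mul_of_one_le_left hn.le (Nat.one_le_cast.2 hq))).trans hρ
  have hheavy : #(heavy x η) ≤ C := by
    have := (hx.card_heavy_mul_le hG hd hη hρ₁ hn₂).trans hC
    exact Nat.cast_le.1 (le_of_mul_le_mul_right this hη)
  have hηd₂ : 44 * (d ^ 2 * η) ≤ 1 := by
    refine le_trans ?_ hηd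
    gcongr
    norm_num
  obtain ⟨L, rfl, hL, hL', hcommon⟩ := hx.exists_dominating hG hGq hδ hq hqd hη hηd₂ hn₁ hρ
    (hGq.card_crowded_mul_card_heavy_le hδ hheavy hn₃)
  have hsparse := hGq L rfl hcommon
  have hsmall : 2 * (((δ : ℝ) + d) * (11 * (d ^ 2 * η))) ≤ 1 := by
    calc 2 * (((δ : ℝ) + d) * (11 * (d ^ 2 * η))) ≤ 2 * ((d + d) * (11 * (d ^ 2 * η))) := by gcongr
      _ = 44 * (d ^ 3 * η) := by ring
      _ ≤ 1 := hηd
  obtain ⟨w, hw⟩ := card_pos.1 (hd.trans hcommon)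
  calc graphRho G ≤ graphRho (rejoin G L) := graphRho_le_of_adjForm_le hx <|
        adjForm_le_adjForm_rejoin hG hx.nonneg hL hL' (by positivity) hsparse hsmall
    _ ≤ matrixRho (matrixJ (Fintype.card W) #L δ) := graphRho_rejoin_le (card_pos.1 hq)
        (ne_of_mem_of_not_mem' (mem_univ w) (notMem_of_mem_commonNbr hw)).symm hsparse

theorem eventually_graphRho_le_of_isJoinSparse (hδ : δ ≤ d) (hq : 1 ≤ q) (hqd : q ≤ d)
    (hqδ : 2 < q + δ) :
    ∀ᶠ n : ℕ in atTop, ∀ (G : SimpleGraph (Fin n)) [DecidableRel G.Adj], IsDegenerate G d →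
      IsJoinSparse G q d δ → graphRho G ≤ matrixRho (matrixJ n q δ) := by
  have hd : (0 : ℝ) < d := Nat.cast_pos.2 (hq.trans hqd)
  obtain ⟨η, hη, hηd⟩ : ∃ η : ℝ, 0 < η ∧ 44 * (d ^ 3 * η) = 1 :=
    ⟨1 / (44 * d ^ 3), by positivity, by field_simp⟩
  obtain ⟨C, hC⟩ := exists_nat_ge (16 * (d : ℝ) ^ 2 / η)
  have hsqrt : Tendsto (fun n : ℕ => η ^ 2 * √(n : ℝ)) atTop atTop :=
    (Real.tendsto_sqrt_atTop.comp tendsto_natCast_atTop_atTop).const_mul_atTop (by positivity)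
  have hlin : Tendsto (fun n : ℕ => η * (n : ℝ)) atTop atTop :=
    tendsto_natCast_atTop_atTop.const_mul_atTop hη
  filter_upwards [eventually_sqrt_le_matrixRho_matrixJ hq hqδ, hlin.eventually_ge_atTop 1,
    hsqrt.eventually_ge_atTop (64 * (d : ℝ) ^ 3), hlin.eventually_ge_atTop ((2 : ℝ) ^ C * C)]
    with n hJ hn₁ hn₂ hn₃ G _ hG hGq
  rcases le_total (graphRho G) √((q : ℝ) * n) with hle | hρ
  · exact hle.trans hJ
  · have := graphRho_le_of_isJoinSparse hG hGq hδ hq hqd hη hηd.le ((div_le_iff₀ hη).1 hC)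
    simp only [Fintype.card_fin] at this
    exact this hρ hn₁ hn₂ hn₃

theorem eventually_graphRho_le_of_free {V : Type*} [Fintype V] {F : SimpleGraph V}
    [DecidableRel F.Adj] (hF : F.IsAcyclic) {A B : Finset V} (hAB : F.IsBipartiteWith A B)
    (hA : #A = q + 1) {a₀ : V} (ha₀ : a₀ ∈ A) (hq : 1 ≤ q) (hqδ : 2 < q + F.degree a₀) :
    ∀ᶠ n : ℕ in atTop, ∀ G : SimpleGraph (Fin n), F.Free G →
      graphRho G ≤ matrixRho (matrixJ n q (F.degree a₀)) := by
  classical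
  have hqd : q ≤ Fintype.card V := by
    have := card_le_univ A
    omega
  filter_upwards [eventually_graphRho_le_of_isJoinSparse (F.degree_lt_card_verts a₀).le hq hqd hqδ]
    with n hn G hG
  exact hn G (isDegenerate_of_free hF hG (Nat.le_add_right _ 2))
    (isJoinSparse_of_free hAB hA.le ha₀ hG)

theorem bddAbove_graphRho_free {V : Type*} (n : ℕ) (F : SimpleGraph V) :
    BddAbove {r : ℝ | ∃ G : SimpleGraph (Fin n), F.Free G ∧ graphRho G = r} := by
  refine ((Set.finite_range fun G : SimpleGraph (Fin n) => graphRho G).subset ?_).bddAbove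
  rintro r ⟨G, -, rfl⟩
  exact Set.mem_range_self G

end Upper

theorem theorem1p4_general {V : Type*} [Fintype V] (F : SimpleGraph V) [DecidableRel F.Adj]
    (hF : F.IsAcyclic) (A B : Finset V) (hAB : F.IsBipartiteWith (A : Set V) (B : Set V))
    (q δ : ℕ) (hq : A.card = q + 1) (hδ : IsLeast ((fun x => F.degree x) '' (A : Set V)) δ)
    (hq1 : 1 ≤ q) (hδ2 : 2 ≤ δ) :
    (∀ n : ℕ, F.Free (splitGraph n q 1)) ∧
    (∀ᶠ n : ℕ in Filter.atTop,
      ((q : ℝ) - 1) / 2 + √((q : ℝ) * n - (3 * (q : ℝ) ^ 2 + 2 * q + 1) / 4) < spex n F ∧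
      spex n F ≤ matrixRho (matrixJ n q δ)) ∧
    (fun n : ℕ => matrixRho (matrixJ n q δ) - (√((q : ℝ) * n) + ((q : ℝ) + δ - 2) / 2))
      =O[Filter.atTop] (fun n : ℕ => 1 / √(n : ℝ)) := by
  have hfree := free_splitGraph_one hF (fun a ha _ hab => notMem_of_isBipartiteWith hAB ha hab)
    (fun a ha => hδ2.trans (hδ.2 ⟨a, ha, rfl⟩)) (q.lt_succ_self.trans_eq hq.symm)
  obtain ⟨a₀, ha₀, rfl⟩ := hδ.1
  refine ⟨hfree, ?_, matrixRho_matrixJ_isBigO _ hq1⟩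
  filter_upwards [eventually_gt_atTop q,
    eventually_graphRho_le_of_free hF hAB hq ha₀ hq1 (by dsimp only at hδ2; omega)] with n hn hupper
  constructor
  · exact (lt_graphRho_splitGraph_one hq1 hn).trans_le
      (le_csSup (bddAbove_graphRho_free n F) ⟨_, hfree n, rfl⟩)
  · refine csSup_le ⟨_, _, hfree n, rfl⟩ ?_
    rintro r ⟨G, hG, rfl⟩
    exact hupper G hG

theorem theorem1p4 {V : Type*} [Fintype V] (F : SimpleGraph V) [DecidableRel F.Adj]
    (hF : F.IsTree) (hcard : 4 ≤ Fintype.card V)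
    (A B : Finset V) (hAB : F.IsBipartiteWith (A : Set V) (B : Set V))
    (hcover : ∀ v, v ∈ A ∨ v ∈ B) (hle : A.card ≤ B.card)
    (q δ : ℕ) (hq : A.card = q + 1) (hδ : IsLeast ((fun x => F.degree x) '' (A : Set V)) δ)
    (hq1 : 1 ≤ q) (hδ2 : 2 ≤ δ) :
    (∀ n : ℕ, q + 2 ≤ n → F.Free (splitGraph n q 1)) ∧
    (∀ᶠ n : ℕ in Filter.atTop,
      ((q : ℝ) - 1) / 2 + √((q : ℝ) * n - (3 * (q : ℝ) ^ 2 + 2 * q + 1) / 4) < spex n F ∧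
      spex n F ≤ matrixRho (matrixJ n q δ)) ∧
    (fun n : ℕ => matrixRho (matrixJ n q δ) - (√((q : ℝ) * n) + ((q : ℝ) + δ - 2) / 2))
      =O[Filter.atTop] (fun n : ℕ => 1 / √(n : ℝ)) := by
  obtain ⟨hfree, hspex, hJ⟩ := theorem1p4_general F hF.isAcyclic A B hAB q δ hq hδ hq1 hδ2
  exact ⟨fun n _ => hfree n, hspex, hJ⟩
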